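/- Let $\Omega\subset\mathbb{R}^3$ be a nonempty connected open set (the undeformed body, in Euclidean space with Cartesian coordinates). A deformation of $\Omega$ is an injective $C^2$ map $\varphi:\Omega\to\mathbb{R}^3$ whose deformation gradient $F=(\partial\varphi^a/\partial X^A)$ is invertible at every point. Write $b=FF^{\mathsf T}$, $c=b^{-1}=F^{-\mathsf T}F^{-1}$, $I_1=\operatorname{tr}b$, $I_2=\tfrac12\left(I_1^2-\operatorname{tr}b^2\right)$, $I_3=\det b$. Fix a regularity class $C^k$ with $1\le k\le\infty$ or $k=\omega$ (real-analytic). A homogeneous compressible isotropic Cauchy elastic solid is given by three arbitrary response functions $\alpha,\beta,\gamma$ of $(I_1,I_2,I_3)$, of class $C^k$ on the set of invariants of positive definite symmetric matrices; its Cauchy stress is $\sigma=\alpha(I_1,I_2,I_3)\,\mathbf{1}+\beta(I_1,I_2,I_3)\,b+\gamma(I_1,I_2,I_3)\,c$, regarded as a field on the current configuration $\varphi(\Omega)$ by means of $\varphi^{-1}$. A deformation $\varphi$ of $\Omega$ is called universal if for every such solid $\sigma$ is differentiable on $\varphi(\Omega)$ and satisfies the equilibrium equations without body forces, $\sum_{j=1}^3\partial\sigma^{ij}/\partial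 x^j=0$ on $\varphi(\Omega)$ for $i=1,2,3$. It is called homogeneous if there are a constant matrix $A$ and a vector $d$ with $\varphi(X)=AX+d$ for all $X\in\Omega$. Then the set of universal deformations of $\Omega$ for homogeneous compressible isotropic Cauchy elastic solids is the set of all homogeneous deformations of $\Omega$. -/

import Mathlib

/-- Three-dimensional Euclidean space, with Cartesian coordinates `x 0, x 1, x 2`. -/
abbrev E3 : Type := EuclideanSpace ℝ (Fin 3)

/-- `3 × 3` real matrices: Cartesian components of second-order tensors. -/
abbrev Mat3 : Type := Matrix (Fin 3) (Fin 3) ℝ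

/-- The partial derivative `∂f/∂x_i` at `x`. -/
noncomputable def partialDeriv {V : Type} [NormedAddCommGroup V] [NormedSpace ℝ V]
    (i : Fin 3) (f : E3 → V) (x : E3) : V :=
  fderiv ℝ f x (EuclideanSpace.single i 1)

/-- The deformation gradient `F^a_A = ∂φ^a/∂X^A` at the material point `X`. -/
noncomputable def defGrad (φ : E3 → E3) (X : E3) : Mat3 :=
  Matrix.of fun a A => partialDeriv A φ X a

/-- A deformation of the body `Ω`: a one-to-one `C²` map with invertible deformation gradient.
No sign of the determinant is imposed. -/
structure IsDeformation (Ω : Set E3) (φ : E3 → E3) : Prop where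
  contDiffOn : ContDiffOn ℝ 2 φ Ω
  injOn : Set.InjOn φ Ω
  det_ne_zero : ∀ X ∈ Ω, (defGrad φ X).det ≠ 0

/-- The deformation is homogeneous: it is (the restriction of) an affine map, `φ(X) = A X + d`. -/
def IsHomogeneous (Ω : Set E3) (φ : E3 → E3) : Prop :=
  ∃ (A : E3 →L[ℝ] E3) (d : E3), ∀ X ∈ Ω, φ X = A X + d

/-- The left Cauchy-Green strain `b^{ab} = F^a_A F^b_A`, at the material point `X`. -/
noncomputable def leftCauchyGreen (φ : E3 → E3) (X : E3) : Mat3 :=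
  defGrad φ X * (defGrad φ X).transpose

/-- The tensor `c_{ab} = (F⁻¹)^A_a (F⁻¹)^A_b`, at the material point `X`. -/
noncomputable def cTensor (φ : E3 → E3) (X : E3) : Mat3 :=
  (defGrad φ X)⁻¹.transpose * (defGrad φ X)⁻¹

/-- The principal invariants `(I₁, I₂, I₃)` of a second-order tensor. -/
noncomputable def principalInvariants (b : Mat3) : ℝ × ℝ × ℝ :=
  (b.trace, (b.trace ^ 2 - (b * b).trace) / 2, b.det)

/-- The values `(I₁, I₂, I₃)` taken by the invariants of left Cauchy-Green strains. -/
def admissibleInvariants : Set (ℝ × ℝ × ℝ) :=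
  {I | ∃ b : Mat3, b.PosDef ∧ principalInvariants b = I}

/-- A homogeneous compressible isotropic Cauchy elastic solid: three response functions of the
principal invariants, of class `C^k`, and otherwise arbitrary. -/
structure IsotropicCauchySolid (k : WithTop ℕ∞) where
  α : ℝ × ℝ × ℝ → ℝ
  β : ℝ × ℝ × ℝ → ℝ
  γ : ℝ × ℝ × ℝ → ℝ
  contDiffOn_α : ContDiffOn ℝ k α admissibleInvariants
  contDiffOn_β : ContDiffOn ℝ k β admissibleInvariants
  contDiffOn_γ : ContDiffOn ℝ k γ admissibleInvariants

/-- The Cauchy stress `σ = α g + β b + γ c` at the material point `X`, where the response functions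
are evaluated at the principal invariants of `b`. -/
noncomputable def IsotropicCauchySolid.stress {k : WithTop ℕ∞} (M : IsotropicCauchySolid k)
    (φ : E3 → E3) (X : E3) : Mat3 :=
  let b := leftCauchyGreen φ X
  let I := principalInvariants b
  M.α I • (1 : Mat3) + M.β I • b + M.γ I • cTensor φ X

/-- The Cauchy stress as a field on the current configuration `φ(Ω)`: at the place `x` it is the
stress at the material point that occupies `x`. -/
noncomputable def IsotropicCauchySolid.spatialStress {k : WithTop ℕ∞} (M : IsotropicCauchySolid k)
    (Ω : Set E3) (φ : E3 → E3) (x : E3) : Mat3 :=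
  M.stress φ (Function.invFunOn φ Ω x)

/-- Equilibrium without body forces of a stress field on a region `C` of space: the field is
differentiable and `∑_b ∂σ^{ab}/∂x^b = 0` at all points of `C`. -/
def InEquilibrium (C : Set E3) (σ : E3 → Mat3) : Prop :=
  ∀ x ∈ C, (∀ a b, DifferentiableAt ℝ (fun y => σ y a b) x) ∧
    ∀ a, ∑ b, partialDeriv b (fun y => σ y a b) x = 0

/-- The deformation `φ` of `Ω` is universal: it satisfies the equilibrium equations without body
forces for every homogeneous compressible isotropic Cauchy elastic solid. -/
def IsUniversal (k : WithTop ℕ∞) (Ω : Set E3) (φ : E3 → E3) : Prop :=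
  ∀ M : IsotropicCauchySolid k, InEquilibrium (φ '' Ω) (M.spatialStress Ω φ)

/-!
A homogeneous deformation has constant stress, so it is universal. The content is the converse, for
which three kinds of materials suffice.

The hydrostatic stresses `I₁ 1` and `I₃ 1` are in equilibrium only if `I₁ = tr b` and
`I₃ = (det F)²` have zero gradient. The stress `b` is in equilibrium only if `div b = 0`. By the
chain rule and Jacobi's formula, `div b` in the current configuration equals the Laplacian of `φ` in
the reference configuration plus a term containing the gradient of `det F`
(`IsDeformation.sum_partialDeriv_leftCauchyGreen`). Hence `φ` is harmonic and
`|∇φ|² = tr b` is constant.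

For smooth `φ` one would conclude from `0 = Δ|∇φ|² = 2 |∇²φ|²`, but `φ` is only of class `C²`. The
mean value property replaces this identity: the components of `∇φ` equal their weighted means over
balls (`integral_radialWeight_mul_fderiv`, which needs two derivatives only), so the weighted mean
of `|∇φ - ∇φ(c)|²` around `c` is the mean of `|∇φ|²` minus `|∇φ(c)|²`, that is, zero
(`fderiv_eq_of_sum_sq_fderiv_eq`). So `∇φ` is locally constant, and `φ` is affine on the connected
set `Ω`.
-/

/-! ### A smooth radial weight -/

section RadialWeight

open Metric

variable {E : Type*} [NormedAddCommGroup E]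

theorem deriv_expNegInvGlue_nonneg (t : ℝ) : 0 ≤ deriv expNegInvGlue t :=
  expNegInvGlue.monotone.deriv_nonneg

theorem deriv_expNegInvGlue_of_neg {t : ℝ} (ht : t < 0) : deriv expNegInvGlue t = 0 := by
  have h : expNegInvGlue =ᶠ[nhds t] fun _ => 0 := by
    filter_upwards [Iio_mem_nhds ht] with s hs
    exact expNegInvGlue.zero_of_nonpos (le_of_lt hs)
  rw [h.deriv_eq, deriv_const]

theorem deriv_expNegInvGlue_pos {t : ℝ} (ht : 0 < t) : 0 < deriv expNegInvGlue t := by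
  have h : expNegInvGlue =ᶠ[nhds t] fun s => Real.exp (-s⁻¹) := by
    filter_upwards [Ioi_mem_nhds ht] with s hs
    simp [expNegInvGlue, not_le.2 (Set.mem_Ioi.1 hs)]
  have h' : HasDerivAt (fun s : ℝ => Real.exp (-s⁻¹)) (Real.exp (-t⁻¹) * (-(-(t ^ 2)⁻¹))) t :=
    (hasDerivAt_inv ht.ne').neg.exp
  rw [h.deriv_eq, h'.deriv, neg_neg]
  positivity

theorem contDiff_deriv_expNegInvGlue : ContDiff ℝ 2 (deriv expNegInvGlue) := by
  have h : ContDiff ℝ (2 + 1) expNegInvGlue := expNegInvGlue.contDiff (n := 3)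
  exact (contDiff_succ_iff_deriv.1 h).2.2

/-- The smooth radial function `exp (-1 / (1 - ‖y‖²))` on the open unit ball, extended by zero. -/
noncomputable def radialBump (y : E) : ℝ := expNegInvGlue (1 - ‖y‖ ^ 2)

/-- The radial weight `w` with `∇ radialBump y = -w(y) y`. It is nonnegative, positive on the open
unit ball and zero outside of it. -/
noncomputable def radialWeight (y : E) : ℝ := 2 * deriv expNegInvGlue (1 - ‖y‖ ^ 2)

theorem radialWeight_nonneg (y : E) : 0 ≤ radialWeight y :=
  mul_nonneg zero_le_two (deriv_expNegInvGlue_nonneg _)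

theorem radialWeight_pos {y : E} (hy : ‖y‖ < 1) : 0 < radialWeight y :=
  mul_pos zero_lt_two (deriv_expNegInvGlue_pos (by nlinarith [norm_nonneg y]))

theorem radialWeight_eq_zero {y : E} (hy : 1 ≤ ‖y‖) : radialWeight y = 0 := by
  -- On the unit sphere itself the derivative vanishes because `0` minimizes `expNegInvGlue`.
  rcases hy.eq_or_lt with h | h
  · have : IsLocalMin expNegInvGlue 0 :=
      Filter.Eventually.of_forall fun s => by
        rw [expNegInvGlue.zero]; exact expNegInvGlue.nonneg s
    simp [radialWeight, ← h, this.deriv_eq_zero]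
  · rw [radialWeight, deriv_expNegInvGlue_of_neg (by nlinarith), mul_zero]

variable [InnerProductSpace ℝ E]

theorem contDiff_radialBump {n : ℕ∞} : ContDiff ℝ n (radialBump : E → ℝ) :=
  expNegInvGlue.contDiff.comp (contDiff_const.sub (contDiff_norm_sq ℝ))

theorem contDiff_radialWeight : ContDiff ℝ 2 (radialWeight : E → ℝ) :=
  contDiff_const.mul (contDiff_deriv_expNegInvGlue.comp (contDiff_const.sub (contDiff_norm_sq ℝ)))

theorem continuous_radialWeight : Continuous (radialWeight : E → ℝ) :=
  contDiff_radialWeight.continuous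

theorem fderiv_radialBump (y v : E) :
    fderiv ℝ radialBump y v = -(radialWeight y * inner ℝ y v) := by
  have h1 : HasDerivAt expNegInvGlue (deriv expNegInvGlue (1 - ‖y‖ ^ 2)) (1 - ‖y‖ ^ 2) :=
    ((expNegInvGlue.contDiff (n := 1)).differentiable (by simp) _).hasDerivAt
  have h2 : HasFDerivAt (fun y : E => 1 - ‖y‖ ^ 2) (-(2 • innerSL ℝ y)) y :=
    (hasStrictFDerivAt_norm_sq y).hasFDerivAt.const_sub 1
  have h3 : HasFDerivAt (radialBump : E → ℝ) _ y := h1.comp_hasFDerivAt y h2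
  rw [h3.fderiv]
  simp [radialWeight]
  ring

theorem fderiv_radialBump_eq_zero {y : E} (hy : 1 ≤ ‖y‖) (v : E) :
    fderiv ℝ radialBump y v = 0 := by
  rw [fderiv_radialBump, radialWeight_eq_zero hy, zero_mul, neg_zero]

variable [FiniteDimensional ℝ E]

theorem hasCompactSupport_radialBump : HasCompactSupport (radialBump : E → ℝ) :=
  HasCompactSupport.intro (isCompact_closedBall 0 1) fun y hy =>
    expNegInvGlue.zero_of_nonpos (by
      have : 1 < ‖y‖ := by simpa using hy
      nlinarith)

theorem hasCompactSupport_radialWeight : HasCompactSupport (radialWeight : E → ℝ) :=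
  HasCompactSupport.intro (isCompact_closedBall 0 1) fun y hy =>
    radialWeight_eq_zero (by
      have : 1 < ‖y‖ := by simpa using hy
      exact this.le)

end RadialWeight

/-! ### The mean value property for gradients of harmonic functions -/

section MeanValue

open Metric MeasureTheory

/-- The directions of differentiation of the two factors can be exchanged under the integral: an
integration by parts turns both sides into `-∫ (∂ᵤ∂ᵥξ) g`. -/
theorem integral_fderiv_mul_fderiv_swap {E : Type*} [NormedAddCommGroup E] [NormedSpace ℝ E]
    [FiniteDimensional ℝ E] [MeasurableSpace E] [BorelSpace E] {μ : Measure E}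
    [μ.IsAddHaarMeasure] {ξ g : E → ℝ} (hξ : ContDiff ℝ 2 ξ) (hξc : HasCompactSupport ξ)
    (hg : ContDiff ℝ 1 g) (u v : E) :
    ∫ y, fderiv ℝ ξ y u * fderiv ℝ g y v ∂μ = ∫ y, fderiv ℝ ξ y v * fderiv ℝ g y u ∂μ := by
  have hd : ∀ w, ContDiff ℝ 1 fun y => fderiv ℝ ξ y w := fun w =>
    (hξ.fderiv_right (m := 1) (by norm_num)).clm_apply contDiff_const
  have hdc : ∀ w, HasCompactSupport fun y => fderiv ℝ ξ y w := fun w => hξc.fderiv_apply ℝ w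
  have hdd : ∀ w z, Continuous fun y => fderiv ℝ (fun y => fderiv ℝ ξ y w) y z := fun w z =>
    ((hd w).continuous_fderiv (by simp)).clm_apply continuous_const
  have hgd : ∀ w, Continuous fun y => fderiv ℝ g y w := fun w =>
    (hg.continuous_fderiv (by simp)).clm_apply continuous_const
  have key : ∀ w z, ∫ y, fderiv ℝ ξ y w * fderiv ℝ g y z ∂μ =
      -∫ y, fderiv ℝ (fun y => fderiv ℝ ξ y w) y z * g y ∂μ := fun w z =>
    integral_mul_fderiv_eq_neg_fderiv_mul_of_integrable
      (((hdd w z).mul hg.continuous).integrable_of_hasCompactSupport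
        (((hdc w).fderiv_apply ℝ z).mul_right))
      (((hd w).continuous.mul (hgd z)).integrable_of_hasCompactSupport (hdc w).mul_right)
      (((hd w).continuous.mul hg.continuous).integrable_of_hasCompactSupport (hdc w).mul_right)
      (fun x _ => (hd w).differentiable (by simp) x)
      (fun x _ => hg.differentiable (by simp) x)
  have hdiff : Differentiable ℝ (fderiv ℝ ξ) :=
    (hξ.fderiv_right (m := 1) (by norm_num)).differentiable (by simp)
  have happ : ∀ w z y, fderiv ℝ (fun y => fderiv ℝ ξ y w) y z = fderiv ℝ (fderiv ℝ ξ) y z w := by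
    intro w z y
    rw [fderiv_clm_apply (hdiff y) (differentiableAt_const w)]
    simp
  rw [key, key]
  congr 2
  ext y
  rw [happ, happ, (hξ.contDiffAt.isSymmSndFDerivAt (by simp)).eq]

variable {E : Type*} [NormedAddCommGroup E] [InnerProductSpace ℝ E] [FiniteDimensional ℝ E]
  [MeasurableSpace E] [BorelSpace E] {ι : Type*} [Fintype ι]

/-- If a `C²` function `f` with compact support is harmonic on a ball, then the first partial
derivatives of `f` have the mean value property with respect to `radialWeight` on this ball.

With `ξ = radialBump`, the derivative in `r` of `∫ radialWeight y * (∂ᵥf)(c + r y)` is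
`-∑ i, ∫ ∂ᵢξ(y) (∂ᵢ∂ᵥf)(c + r y)`, and two integrations by parts turn it into
`-∫ ∂ᵥξ(y) (Δf)(c + r y) = 0`. No third derivative of `f` appears. -/
theorem integral_radialWeight_mul_fderiv (e : OrthonormalBasis ι ℝ E) {f : E → ℝ}
    (hf : ContDiff ℝ 2 f) (hfc : HasCompactSupport f) {c : E} {R : ℝ} (hR : 0 < R)
    (hΔ : ∀ x ∈ ball c R, ∑ i, fderiv ℝ (fun z => fderiv ℝ f z (e i)) x
      (e i) = 0) (v : E) :
    ∫ y, radialWeight y * fderiv ℝ f (c + R • y) v =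
      (∫ y : E, radialWeight y) * fderiv ℝ f c v := by
  have hD : ContDiff ℝ 1 (fderiv ℝ f) := hf.fderiv_right (m := 1) (by norm_num)
  have hd : ∀ w, ContDiff ℝ 1 fun y => fderiv ℝ f y w := fun w => hD.clm_apply contDiff_const
  have happ : ∀ w z y, fderiv ℝ (fun y => fderiv ℝ f y w) y z = fderiv ℝ (fderiv ℝ f) y z w := by
    intro w z y
    rw [fderiv_clm_apply (hD.differentiable (by simp) y) (differentiableAt_const w)]
    simp
  set G : E → ℝ := fun y => fderiv ℝ f y v with hGdef
  have hG : ContDiff ℝ 1 G := hd v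
  have hDG : Continuous (fderiv ℝ G) := hG.continuous_fderiv (by simp)
  obtain ⟨C, hC⟩ := ((hfc.fderiv_apply ℝ v).fderiv ℝ).exists_bound_of_continuous hDG
  have hline : ∀ (r : ℝ) (y : E), HasDerivAt (fun r : ℝ => c + r • y) y r := fun r y => by
    simpa only [id_eq, one_smul] using ((hasDerivAt_id r).smul_const y).const_add c
  have hcont : ∀ r : ℝ, Continuous fun y : E => c + r • y := fun r => by fun_prop
  -- Differentiation of the weighted mean with respect to the radius.
  have hA : ∀ r : ℝ, HasDerivAt (fun r : ℝ => ∫ y : E, radialWeight y * G (c + r • y))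
      (∫ y : E, radialWeight y * fderiv ℝ G (c + r • y) y) r := by
    intro r
    refine (hasDerivAt_integral_of_dominated_loc_of_deriv_le
      (F' := fun (r : ℝ) (y : E) => radialWeight y * fderiv ℝ G (c + r • y) y)
      (bound := fun y => radialWeight y * (C * ‖y‖)) (s := Set.univ)
      Filter.univ_mem ?_ ?_ ?_ ?_ ?_ ?_).2
    · exact Filter.Eventually.of_forall fun r =>
        (continuous_radialWeight.mul (hG.continuous.comp (hcont r))).aestronglyMeasurable
    · exact (continuous_radialWeight.mul (hG.continuous.comp (hcont r))
        ).integrable_of_hasCompactSupport hasCompactSupport_radialWeight.mul_right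
    · exact (continuous_radialWeight.mul
        ((hDG.comp (hcont r)).clm_apply continuous_id)).aestronglyMeasurable
    · refine Filter.Eventually.of_forall fun y r _ => ?_
      rw [norm_mul, Real.norm_of_nonneg (radialWeight_nonneg y)]
      exact mul_le_mul_of_nonneg_left (((fderiv ℝ G (c + r • y)).le_opNorm y).trans
        (mul_le_mul_of_nonneg_right (hC _) (norm_nonneg y))) (radialWeight_nonneg y)
    · exact (continuous_radialWeight.mul (continuous_const.mul continuous_norm)
        ).integrable_of_hasCompactSupport hasCompactSupport_radialWeight.mul_right
    · exact Filter.Eventually.of_forall fun y r _ =>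
        ((hG.differentiable (by simp) _).hasFDerivAt.comp_hasDerivAt r (hline r y)).const_mul _
  -- The radial derivative vanishes.
  have hA0 : ∀ r ∈ Set.Ioo 0 R, ∫ y : E, radialWeight y * fderiv ℝ G (c + r • y) y = 0 := by
    intro r hr
    let g : ι → E → ℝ := fun i y => fderiv ℝ f (c + r • y) (e i)
    have hg : ∀ i, ContDiff ℝ 1 (g i) := fun i =>
      (hd (e i)).comp (contDiff_const.add (contDiff_const.smul contDiff_id))
    have hgd : ∀ i y z, fderiv ℝ (g i) y z = r * fderiv ℝ (fderiv ℝ f) (c + r • y) z (e i) := by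
      intro i y z
      have h1 : HasFDerivAt (fun y : E => c + r • y) (r • ContinuousLinearMap.id ℝ E) y :=
        ((hasFDerivAt_id y).const_smul r).const_add c
      have h0 : DifferentiableAt ℝ (fun y => fderiv ℝ f y (e i)) (c + r • y) :=
        (hd (e i)).differentiable (by simp) _
      have h2 := h0.hasFDerivAt.comp y h1
      have h3 : fderiv ℝ (g i) y = _ := h2.fderiv
      rw [h3]
      simp [happ]
    have hξ : ContDiff ℝ 2 (radialBump : E → ℝ) := contDiff_radialBump (n := 2)
    have hdξ : ∀ w, Continuous fun y : E => fderiv ℝ radialBump y w := fun w =>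
      (hξ.continuous_fderiv (by simp)).clm_apply continuous_const
    have hint : ∀ i w z, Integrable fun y : E => fderiv ℝ radialBump y w * fderiv ℝ (g i) y z :=
      fun i w z => ((hdξ w).mul (((hg i).continuous_fderiv (by simp)).clm_apply
        continuous_const)).integrable_of_hasCompactSupport
          (hasCompactSupport_radialBump.fderiv_apply ℝ w).mul_right
    have h1 : ∀ y : E, r * (radialWeight y * fderiv ℝ G (c + r • y) y) =
        -∑ i, fderiv ℝ radialBump y (e i) * fderiv ℝ (g i) y v := by
      intro y
      have hy : y = ∑ i, inner ℝ (e i) y • e i := (e.sum_repr' y).symm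
      have hsym : ∀ i, fderiv ℝ (g i) y v = r * fderiv ℝ G (c + r • y) (e i) := by
        intro i
        rw [hgd, hGdef, happ, (hf.contDiffAt.isSymmSndFDerivAt (by simp)).eq]
      have hbump : ∀ i, fderiv ℝ radialBump y (e i) = -(radialWeight y * inner ℝ (e i) y) :=
        fun i => by rw [fderiv_radialBump, real_inner_comm]
      conv_lhs => enter [2, 2]; rw [hy, map_sum]
      simp only [hsym, hbump, map_smul, smul_eq_mul, Finset.mul_sum, ← Finset.sum_neg_distrib, ← hy]
      exact Finset.sum_congr rfl fun i _ => by ring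
    have h2 : ∀ y : E, ∑ i, fderiv ℝ radialBump y v * fderiv ℝ (g i) y (e i) = 0 := by
      intro y
      by_cases hy : 1 ≤ ‖y‖
      · simp [fderiv_radialBump_eq_zero hy]
      · have hmem : c + r • y ∈ ball c R := by
          rw [mem_ball, dist_eq_norm, add_sub_cancel_left, norm_smul, Real.norm_of_nonneg hr.1.le]
          nlinarith [hr.1, hr.2, norm_nonneg y]
        have := hΔ _ hmem
        simp only [happ] at this
        simp only [hgd, ← Finset.mul_sum]
        rw [this, mul_zero, mul_zero]
    have h3 : r * ∫ y : E, radialWeight y * fderiv ℝ G (c + r • y) y = 0 := by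
      rw [← integral_const_mul]
      simp only [h1]
      rw [integral_neg, integral_finsetSum _ fun i _ => hint i _ _]
      rw [Finset.sum_congr rfl fun i _ => integral_fderiv_mul_fderiv_swap hξ
        hasCompactSupport_radialBump (hg i) (e i) v]
      rw [← integral_finsetSum _ fun i _ => hint i _ _]
      simp [h2]
    exact (mul_eq_zero.1 h3).resolve_left hr.1.ne'
  obtain ⟨r, hr, h⟩ := exists_hasDerivAt_eq_slope _ _ hR
    (fun r _ => (hA r).continuousAt.continuousWithinAt) (fun r _ => hA r)
  rw [hA0 r hr, eq_comm, div_eq_zero_iff] at h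
  have := h.resolve_right (by linarith)
  simp only [zero_smul, add_zero] at this
  rw [integral_mul_const] at this
  exact sub_eq_zero.1 this

/-- A finite family of harmonic functions whose gradients have constant total squared length has
constant gradients.

The weighted mean of `∑ (∂ᵢfₐ - ∂ᵢfₐ(c))²` vanishes, since by the mean value property it is the
weighted mean of `∑ (∂ᵢfₐ)²` minus `∑ (∂ᵢfₐ(c))²`. -/
theorem fderiv_eq_of_sum_sq_fderiv_eq (e : OrthonormalBasis ι ℝ E) {κ : Type*} [Fintype κ]
    {f : κ → E → ℝ}
    (hf : ∀ a, ContDiff ℝ 2 (f a)) (hfc : ∀ a, HasCompactSupport (f a)) {c : E}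
    {R m : ℝ} (hR : 0 < R)
    (hΔ : ∀ a, ∀ x ∈ ball c R, ∑ i, fderiv ℝ (fun z => fderiv ℝ (f a) z
      (e i)) x (e i) = 0)
    (hm : ∀ x ∈ ball c R, ∑ a, ∑ i, (fderiv ℝ (f a) x (e i)) ^ 2 = m)
    {x : E} (hx : x ∈ ball c R) (a : κ) (i : ι) :
    fderiv ℝ (f a) x (e i) =
      fderiv ℝ (f a) c (e i) := by
  let V : κ → ι → E → ℝ := fun a i y => fderiv ℝ (f a) (c + R • y) (e i)
  have hV : ∀ a i, Continuous (V a i) := fun a i =>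
    (((hf a).continuous_fderiv (by simp)).comp (show Continuous fun y : E => c + R • y by
      fun_prop)).clm_apply continuous_const
  have hmem : ∀ y : E, ‖y‖ < 1 → c + R • y ∈ ball c R := by
    intro y hy
    rw [mem_ball, dist_eq_norm, add_sub_cancel_left, norm_smul, Real.norm_of_nonneg hR.le]
    nlinarith
  let S : E → ℝ := fun y => radialWeight y * ∑ a, ∑ i, (V a i y - V a i 0) ^ 2
  have hS : Continuous S := continuous_radialWeight.mul (by fun_prop)
  have hS0 : 0 ≤ S := fun y => mul_nonneg (radialWeight_nonneg y) (by positivity)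
  have hw : Integrable (radialWeight : E → ℝ) :=
    continuous_radialWeight.integrable_of_hasCompactSupport hasCompactSupport_radialWeight
  have hwV : ∀ a i, Integrable fun y : E => radialWeight y * V a i y := fun a i =>
    (continuous_radialWeight.mul (hV a i)).integrable_of_hasCompactSupport
      hasCompactSupport_radialWeight.mul_right
  have hmean : ∀ a i, ∫ y, radialWeight y * V a i y = (∫ y : E, radialWeight y) * V a i 0 := by
    intro a i
    simpa [V] using integral_radialWeight_mul_fderiv e (hf a) (hfc a) hR (hΔ a) (e i)
  have hV0 : ∑ a, ∑ i, V a i 0 ^ 2 = m := hm _ (hmem 0 (by simp))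
  have hexp : ∀ y, S y = 2 * m * radialWeight y
      - ∑ a, ∑ i, 2 * V a i 0 * (radialWeight y * V a i y) := by
    intro y
    by_cases hy : ‖y‖ < 1
    · have h1 : ∑ a, ∑ i, V a i y ^ 2 = m := hm _ (hmem y hy)
      have h2 : ∑ a, ∑ i, (V a i y - V a i 0) ^ 2 =
          2 * m - ∑ a, ∑ i, 2 * V a i 0 * V a i y := by
        rw [two_mul, ← h1]
        nth_rewrite 2 [h1]
        rw [← hV0]
        simp only [← Finset.sum_add_distrib, ← Finset.sum_sub_distrib]
        exact Finset.sum_congr rfl fun a _ => Finset.sum_congr rfl fun i _ => by ring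
      change radialWeight y * ∑ a, ∑ i, (V a i y - V a i 0) ^ 2 = _
      rw [h2, mul_sub]
      congr 1
      · ring
      · simp only [Finset.mul_sum]
        exact Finset.sum_congr rfl fun a _ => Finset.sum_congr rfl fun i _ => by ring
    · simp [S, radialWeight_eq_zero (not_lt.1 hy)]
  have hint : ∫ y, S y = 0 := by
    simp only [hexp]
    have hi : ∀ a i, Integrable fun y : E => 2 * V a i 0 * (radialWeight y * V a i y) :=
      fun a i => (hwV a i).const_mul _
    rw [integral_sub (hw.const_mul _)
      (integrable_finsetSum _ fun a _ => integrable_finsetSum _ fun i _ => hi a i),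
      integral_finsetSum _ fun a _ => integrable_finsetSum _ fun i _ => hi a i]
    simp only [integral_finsetSum _ fun i _ => hi _ i, integral_const_mul, hmean]
    rw [← hV0, Finset.mul_sum, Finset.sum_mul, ← Finset.sum_sub_distrib]
    refine Finset.sum_eq_zero fun a _ => ?_
    rw [Finset.mul_sum, Finset.sum_mul, ← Finset.sum_sub_distrib]
    exact Finset.sum_eq_zero fun i _ => by ring
  have hSz : S = 0 := by
    rw [integral_eq_zero_iff_of_nonneg hS0 (hS.integrable_of_hasCompactSupport
      hasCompactSupport_radialWeight.mul_right)] at hint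
    exact (hS.ae_eq_iff_eq volume continuous_const).1 hint
  have hy : ‖R⁻¹ • (x - c)‖ < 1 := by
    rw [mem_ball, dist_eq_norm] at hx
    rw [norm_smul, norm_inv, Real.norm_of_nonneg hR.le, inv_mul_lt_iff₀ hR]
    simpa using hx
  have hz := (mul_eq_zero.1 (congrFun hSz (R⁻¹ • (x - c)))).resolve_left (radialWeight_pos hy).ne'
  rw [Finset.sum_eq_zero_iff_of_nonneg fun a _ => by positivity] at hz
  have hza := hz a (Finset.mem_univ a)
  rw [Finset.sum_eq_zero_iff_of_nonneg fun i _ => by positivity] at hza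
  have hzai := sub_eq_zero.1 (pow_eq_zero_iff two_ne_zero |>.1 (hza i (Finset.mem_univ i)))
  simpa [V, smul_smul, hR.ne'] using hzai

end MeanValue

/-! ### Partial derivatives and the deformation gradient -/

section Kinematics

open Metric

theorem fderiv_eq_sum_partialDeriv {V : Type} [NormedAddCommGroup V] [NormedSpace ℝ V]
    (f : E3 → V) (x v : E3) : fderiv ℝ f x v = ∑ i, v i • partialDeriv i f x := by
  have hv : v = ∑ i, v i • EuclideanSpace.single i (1 : ℝ) := by
    simpa using ((EuclideanSpace.basisFun (Fin 3) ℝ).sum_repr v).symm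
  conv_lhs => rw [hv, map_sum]
  simp [partialDeriv]

theorem fderiv_eq_zero_of_partialDeriv {V : Type} [NormedAddCommGroup V] [NormedSpace ℝ V]
    {f : E3 → V} {x : E3} (h : ∀ i, partialDeriv i f x = 0) : fderiv ℝ f x = 0 := by
  ext v
  simp [fderiv_eq_sum_partialDeriv, h]

theorem fderiv_apply_eq_sum_defGrad (φ : E3 → E3) (X v : E3) (a : Fin 3) :
    fderiv ℝ φ X v a = ∑ A, defGrad φ X a A * v A := by
  rw [fderiv_eq_sum_partialDeriv]
  simp [defGrad, mul_comm]

variable {Ω : Set E3} {φ : E3 → E3}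

theorem IsDeformation.contDiffAt (hφ : IsDeformation Ω φ) (hΩ : IsOpen Ω) {X : E3} (hX : X ∈ Ω) :
    ContDiffAt ℝ 2 φ X :=
  hφ.contDiffOn.contDiffAt (hΩ.mem_nhds hX)

theorem IsDeformation.differentiableAt (hφ : IsDeformation Ω φ) (hΩ : IsOpen Ω) {X : E3}
    (hX : X ∈ Ω) : DifferentiableAt ℝ φ X :=
  (hφ.contDiffAt hΩ hX).differentiableAt (by simp)

theorem defGrad_eq_partialDeriv_apply {X : E3} (h : DifferentiableAt ℝ φ X) (a A : Fin 3) :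
    defGrad φ X a A = partialDeriv A (fun Y => φ Y a) X := by
  have h' : HasFDerivAt (fun Y => φ Y a)
      ((EuclideanSpace.proj a : E3 →L[ℝ] ℝ).comp (fderiv ℝ φ X)) X :=
    (EuclideanSpace.proj a : E3 →L[ℝ] ℝ).hasFDerivAt.comp X h.hasFDerivAt
  simp [partialDeriv, h'.fderiv, defGrad]

theorem IsDeformation.hasFDerivAt_defGrad (hφ : IsDeformation Ω φ) (hΩ : IsOpen Ω) {X : E3}
    (hX : X ∈ Ω) (a A : Fin 3) :
    HasFDerivAt (fun Y => defGrad φ Y a A) ((EuclideanSpace.proj a : E3 →L[ℝ] ℝ).comp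
      ((fderiv ℝ (fderiv ℝ φ) X).flip (EuclideanSpace.single A 1))) X := by
  have h1 : HasFDerivAt (fderiv ℝ φ) (fderiv ℝ (fderiv ℝ φ) X) X :=
    (((hφ.contDiffAt hΩ hX).fderiv_right (m := 1) (by norm_num)).differentiableAt
      (by simp)).hasFDerivAt
  have h2 := h1.clm_apply (hasFDerivAt_const (EuclideanSpace.single A (1 : ℝ)) X)
  have h3 := (EuclideanSpace.proj a : E3 →L[ℝ] ℝ).hasFDerivAt.comp X h2
  refine h3.congr_fderiv ?_
  ext v
  simp

theorem IsDeformation.differentiableAt_defGrad (hφ : IsDeformation Ω φ) (hΩ : IsOpen Ω) {X : E3}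
    (hX : X ∈ Ω) (a A : Fin 3) : DifferentiableAt ℝ (fun Y => defGrad φ Y a A) X :=
  (hφ.hasFDerivAt_defGrad hΩ hX a A).differentiableAt

/-- Symmetry of the second derivatives `∂²φ^a/∂X^A∂X^C`. -/
theorem IsDeformation.partialDeriv_defGrad_comm (hφ : IsDeformation Ω φ) (hΩ : IsOpen Ω) {X : E3}
    (hX : X ∈ Ω) (a A C : Fin 3) :
    partialDeriv C (fun Y => defGrad φ Y a A) X = partialDeriv A (fun Y => defGrad φ Y a C) X := by
  rw [partialDeriv, partialDeriv, (hφ.hasFDerivAt_defGrad hΩ hX a A).fderiv,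
    (hφ.hasFDerivAt_defGrad hΩ hX a C).fderiv]
  simp [((hφ.contDiffAt hΩ hX).isSymmSndFDerivAt (by simp)).eq (EuclideanSpace.single C 1)]

theorem partialDeriv_mul {f g : E3 → ℝ} {x : E3} (hf : DifferentiableAt ℝ f x)
    (hg : DifferentiableAt ℝ g x) (i : Fin 3) :
    partialDeriv i (fun y => f y * g y) x =
      f x * partialDeriv i g x + g x * partialDeriv i f x := by
  simp [partialDeriv, fderiv_fun_mul hf hg]

theorem partialDeriv_sum {ι : Type} {s : Finset ι} {f : ι → E3 → ℝ} {x : E3}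
    (hf : ∀ j ∈ s, DifferentiableAt ℝ (f j) x) (i : Fin 3) :
    partialDeriv i (fun y => ∑ j ∈ s, f j y) x = ∑ j ∈ s, partialDeriv i (f j) x := by
  simp [partialDeriv, fderiv_fun_sum hf]

/-- Jacobi's formula `∂ᵢ(det M) = tr (adj M · ∂ᵢM)`. -/
theorem partialDeriv_det {M : E3 → Mat3} {x : E3}
    (hM : ∀ a b, DifferentiableAt ℝ (fun y => M y a b) x) (i : Fin 3) :
    DifferentiableAt ℝ (fun y => (M y).det) x ∧
      partialDeriv i (fun y => (M y).det) x =
        ∑ b, ∑ c, (M x).adjugate c b * partialDeriv i (fun y => M y b c) x := by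
  have h : ∀ a b, HasFDerivAt (fun y => M y a b) (fderiv ℝ (fun y => M y a b) x) x :=
    fun a b => (hM a b).hasFDerivAt
  have key := (((((((h 0 0).fun_mul (h 1 1)).fun_mul (h 2 2)).fun_sub
    (((h 0 0).fun_mul (h 1 2)).fun_mul (h 2 1))).fun_sub
    (((h 0 1).fun_mul (h 1 0)).fun_mul (h 2 2))).fun_add
    (((h 0 1).fun_mul (h 1 2)).fun_mul (h 2 0))).fun_add
    (((h 0 2).fun_mul (h 1 0)).fun_mul (h 2 1))).fun_sub
    (((h 0 2).fun_mul (h 1 1)).fun_mul (h 2 0))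
  simp only [Matrix.det_fin_three]
  refine ⟨key.differentiableAt, ?_⟩
  rw [partialDeriv, key.fderiv]
  simp [Fin.sum_univ_three, Matrix.adjugate_fin_three, partialDeriv]
  ring

/-- The inverse deformation is differentiable, with derivative `F⁻¹`. -/
theorem IsDeformation.exists_hasFDerivAt_invFunOn (hφ : IsDeformation Ω φ) (hΩ : IsOpen Ω)
    {X : E3} (hX : X ∈ Ω) :
    ∃ L : E3 →L[ℝ] E3, HasFDerivAt (Function.invFunOn φ Ω) L (φ X) ∧
      ∀ v C, L v C = ∑ b, (defGrad φ X)⁻¹ C b * v b := by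
  have hdet : IsUnit (defGrad φ X).det := (hφ.det_ne_zero X hX).isUnit
  let L : E3 →L[ℝ] E3 := (Matrix.toEuclideanLin (defGrad φ X)⁻¹).toContinuousLinearMap
  have hL : ∀ v C, L v C = ∑ b, (defGrad φ X)⁻¹ C b * v b := fun v C => by
    simp [L, Matrix.mulVec, dotProduct]
  have hF : ∀ v, (fderiv ℝ φ X v).ofLp = (defGrad φ X).mulVec v.ofLp := fun v => by
    ext a
    simp [fderiv_apply_eq_sum_defGrad, Matrix.mulVec, dotProduct]
  have hL' : ∀ v, (L v).ofLp = (defGrad φ X)⁻¹.mulVec v.ofLp := fun v => by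
    ext a
    simp [hL, Matrix.mulVec, dotProduct]
  let e : E3 ≃L[ℝ] E3 := ContinuousLinearEquiv.equivOfInverse (fderiv ℝ φ X) L
    (fun v => by
      apply WithLp.ofLp_injective
      rw [hL', hF, Matrix.mulVec_mulVec, Matrix.nonsing_inv_mul _ hdet, Matrix.one_mulVec])
    (fun v => by
      apply WithLp.ofLp_injective
      rw [hF, hL', Matrix.mulVec_mulVec, Matrix.mul_nonsing_inv _ hdet, Matrix.one_mulVec])
  have he : HasStrictFDerivAt φ (e : E3 →L[ℝ] E3) X :=
    (hφ.contDiffAt hΩ hX).hasStrictFDerivAt (by simp)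
  refine ⟨L, (he.to_local_left_inverse ?_).hasFDerivAt, hL⟩
  filter_upwards [hΩ.mem_nhds hX] with Y hY
  exact hφ.injOn.leftInvOn_invFunOn hY

theorem IsDeformation.invFunOn_apply (hφ : IsDeformation Ω φ) {X : E3} (hX : X ∈ Ω) :
    Function.invFunOn φ Ω (φ X) = X :=
  hφ.injOn.leftInvOn_invFunOn hX

/-- The chain rule `∂h/∂x^b = (F⁻¹)^C_b ∂h/∂X^C` for a material field `h`. -/
theorem IsDeformation.partialDeriv_comp_invFunOn (hφ : IsDeformation Ω φ) (hΩ : IsOpen Ω)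
    {X : E3} (hX : X ∈ Ω) {h : E3 → ℝ} (hh : DifferentiableAt ℝ h X) (b : Fin 3) :
    partialDeriv b (fun y => h (Function.invFunOn φ Ω y)) (φ X) =
      ∑ C, (defGrad φ X)⁻¹ C b * partialDeriv C h X := by
  obtain ⟨L, hL, hLv⟩ := hφ.exists_hasFDerivAt_invFunOn hΩ hX
  have hh' : HasFDerivAt h (fderiv ℝ h X) (Function.invFunOn φ Ω (φ X)) := by
    rw [hφ.invFunOn_apply hX]
    exact hh.hasFDerivAt
  have hc : fderiv ℝ (fun y => h (Function.invFunOn φ Ω y)) (φ X) = _ := (hh'.comp (φ X) hL).fderiv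
  rw [partialDeriv, hc, ContinuousLinearMap.comp_apply, fderiv_eq_sum_partialDeriv]
  simp [hLv]

/-- A material field whose spatial gradient vanishes has vanishing material gradient. -/
theorem IsDeformation.fderiv_eq_zero_of_comp_invFunOn (hφ : IsDeformation Ω φ) (hΩ : IsOpen Ω)
    {X : E3} (hX : X ∈ Ω) {h : E3 → ℝ} (hh : DifferentiableAt ℝ h X)
    (h0 : ∀ b, partialDeriv b (fun y => h (Function.invFunOn φ Ω y)) (φ X) = 0) :
    fderiv ℝ h X = 0 := by
  have hdet : IsUnit (defGrad φ X).det := (hφ.det_ne_zero X hX).isUnit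
  have h1 : Matrix.vecMul (fun C => partialDeriv C h X) (defGrad φ X)⁻¹ = 0 := by
    ext b
    rw [Pi.zero_apply, ← h0 b, hφ.partialDeriv_comp_invFunOn hΩ hX hh]
    simp [Matrix.vecMul, dotProduct, mul_comm]
  have h2 := congrArg (fun v => Matrix.vecMul v (defGrad φ X)) h1
  simp only [Matrix.vecMul_vecMul, Matrix.nonsing_inv_mul _ hdet, Matrix.vecMul_one,
    Matrix.zero_vecMul] at h2
  exact fderiv_eq_zero_of_partialDeriv fun i => congrFun h2 i

theorem leftCauchyGreen_apply (φ : E3 → E3) (X : E3) (a b : Fin 3) :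
    leftCauchyGreen φ X a b = ∑ A, defGrad φ X a A * defGrad φ X b A := by
  simp [leftCauchyGreen, Matrix.mul_apply]

theorem det_leftCauchyGreen (φ : E3 → E3) (X : E3) :
    (leftCauchyGreen φ X).det = (defGrad φ X).det ^ 2 := by
  rw [leftCauchyGreen, Matrix.det_mul, Matrix.det_transpose, sq]

theorem IsDeformation.differentiableAt_leftCauchyGreen (hφ : IsDeformation Ω φ) (hΩ : IsOpen Ω)
    {X : E3} (hX : X ∈ Ω) (a b : Fin 3) :
    DifferentiableAt ℝ (fun Y => leftCauchyGreen φ Y a b) X := by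
  simp only [leftCauchyGreen_apply]
  exact DifferentiableAt.fun_sum fun A _ =>
    (hφ.differentiableAt_defGrad hΩ hX a A).fun_mul (hφ.differentiableAt_defGrad hΩ hX b A)

/-- `∂b^{ab}/∂x^b = Δφ^a + F^a_A ∂_A(log |det F|)`, so where `det F` is stationary the divergence
of `b` in the current configuration is the Laplacian of `φ` in the reference configuration. -/
theorem IsDeformation.sum_partialDeriv_leftCauchyGreen (hφ : IsDeformation Ω φ) (hΩ : IsOpen Ω)
    {X : E3} (hX : X ∈ Ω) (hdet : fderiv ℝ (fun Y => (defGrad φ Y).det) X = 0) (a : Fin 3) :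
    ∑ b, partialDeriv b (fun y => leftCauchyGreen φ (Function.invFunOn φ Ω y) a b) (φ X) =
      ∑ A, partialDeriv A (fun Y => defGrad φ Y a A) X := by
  have hu : IsUnit (defGrad φ X).det := (hφ.det_ne_zero X hX).isUnit
  have hD := hφ.differentiableAt_defGrad hΩ hX
  set G := (defGrad φ X)⁻¹ with hG
  let P : Fin 3 → Fin 3 → Fin 3 → ℝ := fun a A C => partialDeriv C (fun Y => defGrad φ Y a A) X
  have hP : ∀ a A C, P a A C = P a C A := hφ.partialDeriv_defGrad_comm hΩ hX
  have hGF : ∀ C A, ∑ b, G C b * defGrad φ X b A = (1 : Mat3) C A := by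
    intro C A
    rw [← Matrix.nonsing_inv_mul _ hu, Matrix.mul_apply]
  have htr : ∀ A, ∑ b, ∑ C, G C b * P b C A = 0 := by
    intro A
    have h1 := (partialDeriv_det hD A).2
    rw [partialDeriv, hdet, zero_apply] at h1
    simp only [hG, Matrix.inv_def, Matrix.smul_apply, smul_eq_mul, mul_assoc, ← Finset.mul_sum]
    rw [← h1, mul_zero]
  have hb : ∀ b C, partialDeriv C (fun Y => leftCauchyGreen φ Y a b) X =
      ∑ A, (defGrad φ X a A * P b A C + defGrad φ X b A * P a A C) := by
    intro b C
    simp only [leftCauchyGreen_apply]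
    rw [partialDeriv_sum fun A _ => (hD a A).fun_mul (hD b A)]
    exact Finset.sum_congr rfl fun A _ => partialDeriv_mul (hD a A) (hD b A) C
  calc ∑ b, partialDeriv b (fun y => leftCauchyGreen φ (Function.invFunOn φ Ω y) a b) (φ X)
      = ∑ b, ∑ C, G C b * ∑ A, (defGrad φ X a A * P b A C + defGrad φ X b A * P a A C) := by
        refine Finset.sum_congr rfl fun b _ => ?_
        rw [hφ.partialDeriv_comp_invFunOn hΩ hX (hφ.differentiableAt_leftCauchyGreen hΩ hX a b)]
        simp only [hb, hG]
    _ = ∑ A, defGrad φ X a A * ∑ b, ∑ C, G C b * P b C A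
          + ∑ A, ∑ C, P a A C * ∑ b, G C b * defGrad φ X b A := by
        simp only [fun b A C => hP b A C, Fin.sum_univ_three]
        ring
    _ = ∑ A, P a A A := by
        simp [htr, hGF, Matrix.one_apply]

end Kinematics

/-! ### Consequences of universality -/

section Universality

variable {Ω : Set E3} {φ : E3 → E3} {k : WithTop ℕ∞}

/-- The material with constant `α = 0`, `β = 1`, `γ = 0` has stress `b`. -/
theorem IsUniversal.sum_partialDeriv_leftCauchyGreen_eq_zero (hu : IsUniversal k Ω φ) {X : E3}
    (hX : X ∈ Ω) (a : Fin 3) :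
    ∑ b, partialDeriv b (fun y => leftCauchyGreen φ (Function.invFunOn φ Ω y) a b) (φ X) = 0 := by
  have h := (hu ⟨fun _ => 0, fun _ => 1, fun _ => 0, contDiffOn_const, contDiffOn_const,
    contDiffOn_const⟩ (φ X) (Set.mem_image_of_mem φ hX)).2 a
  simpa [IsotropicCauchySolid.spatialStress, IsotropicCauchySolid.stress] using h

/-- The material with `β = γ = 0` is under a hydrostatic stress `α 1`, whose divergence is the
gradient of `α`. -/
theorem IsUniversal.partialDeriv_response_eq_zero (hu : IsUniversal k Ω φ)
    {α : ℝ × ℝ × ℝ → ℝ} (hα : ContDiff ℝ k α) {X : E3} (hX : X ∈ Ω) (a : Fin 3) :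
    partialDeriv a (fun y => α (principalInvariants (leftCauchyGreen φ
      (Function.invFunOn φ Ω y)))) (φ X) = 0 := by
  have h := (hu ⟨α, fun _ => 0, fun _ => 0, hα.contDiffOn, contDiffOn_const,
    contDiffOn_const⟩ (φ X) (Set.mem_image_of_mem φ hX)).2 a
  rw [Finset.sum_eq_single a] at h
  · simpa [IsotropicCauchySolid.spatialStress, IsotropicCauchySolid.stress] using h
  · intro b _ hb
    simp [IsotropicCauchySolid.spatialStress, IsotropicCauchySolid.stress, hb.symm, partialDeriv]
  · simp

theorem trace_leftCauchyGreen (φ : E3 → E3) (X : E3) :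
    (leftCauchyGreen φ X).trace = ∑ a, ∑ A, defGrad φ X a A ^ 2 := by
  simp [Matrix.trace, leftCauchyGreen_apply, sq]

theorem IsUniversal.fderiv_trace_eq_zero (hφ : IsDeformation Ω φ) (hu : IsUniversal k Ω φ)
    (hΩ : IsOpen Ω) {X : E3} (hX : X ∈ Ω) :
    DifferentiableAt ℝ (fun Y => (leftCauchyGreen φ Y).trace) X ∧
      fderiv ℝ (fun Y => (leftCauchyGreen φ Y).trace) X = 0 := by
  have hd : DifferentiableAt ℝ (fun Y => (leftCauchyGreen φ Y).trace) X :=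
    DifferentiableAt.fun_sum fun a _ => hφ.differentiableAt_leftCauchyGreen hΩ hX a a
  exact ⟨hd, hφ.fderiv_eq_zero_of_comp_invFunOn hΩ hX hd
    (hu.partialDeriv_response_eq_zero contDiff_fst hX)⟩

theorem IsUniversal.fderiv_det_defGrad_eq_zero (hφ : IsDeformation Ω φ) (hu : IsUniversal k Ω φ)
    (hΩ : IsOpen Ω) {X : E3} (hX : X ∈ Ω) : fderiv ℝ (fun Y => (defGrad φ Y).det) X = 0 := by
  have hd : DifferentiableAt ℝ (fun Y => (defGrad φ Y).det) X :=
    (partialDeriv_det (hφ.differentiableAt_defGrad hΩ hX) 0).1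
  have h := hφ.fderiv_eq_zero_of_comp_invFunOn hΩ hX (hd.fun_pow 2) fun b => by
    simpa [principalInvariants, det_leftCauchyGreen] using
      hu.partialDeriv_response_eq_zero (contDiff_snd.snd) hX b
  rw [fderiv_fun_pow 2 hd] at h
  have h2 : ((2 : ℕ) • (defGrad φ X).det ^ (2 - 1)) ≠ 0 := by
    simpa using hφ.det_ne_zero X hX
  exact (smul_eq_zero.1 h).resolve_left h2

/-- A universal deformation is harmonic as a map of the reference configuration. -/
theorem IsUniversal.sum_partialDeriv_defGrad_eq_zero (hφ : IsDeformation Ω φ)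
    (hu : IsUniversal k Ω φ) (hΩ : IsOpen Ω) {X : E3} (hX : X ∈ Ω) (a : Fin 3) :
    ∑ A, partialDeriv A (fun Y => defGrad φ Y a A) X = 0 := by
  rw [← hφ.sum_partialDeriv_leftCauchyGreen hΩ hX (hu.fderiv_det_defGrad_eq_zero hφ hΩ hX),
    hu.sum_partialDeriv_leftCauchyGreen_eq_zero hX]

end Universality

/-! ### Rigidity -/

section Rigidity

open Metric

variable {Ω : Set E3} {φ : E3 → E3}

/-- A harmonic deformation for which `tr b` is constant has locally constant deformation
gradient. Multiplication by a bump function reduces this to globally defined functions. -/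
theorem IsDeformation.eventually_defGrad_eq (hφ : IsDeformation Ω φ) (hΩ : IsOpen Ω) {m : ℝ}
    (htr : ∀ X ∈ Ω, ∑ a, ∑ A, defGrad φ X a A ^ 2 = m)
    (hΔ : ∀ X ∈ Ω, ∀ a, ∑ A, partialDeriv A (fun Y => defGrad φ Y a A) X = 0)
    {X : E3} (hX : X ∈ Ω) : ∀ᶠ Y in nhds X, defGrad φ Y = defGrad φ X := by
  obtain ⟨ρ, hρ, hball⟩ := Metric.isOpen_iff.1 hΩ X hX
  let χ : ContDiffBump X := ⟨ρ / 3, ρ / 2, by positivity, by linarith⟩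
  let f : Fin 3 → E3 → ℝ := fun a Y => χ Y * φ Y a
  have hsupp : ∀ a, tsupport (f a) ⊆ closedBall X (ρ / 2) := fun a =>
    (tsupport_mul_subset_left).trans χ.tsupport_eq.subset
  have hf : ∀ a, ContDiff ℝ 2 (f a) := fun a => contMDiff_iff_contDiff.1 <|
      contMDiff_of_tsupport fun Y hY => by
    have hYΩ : Y ∈ Ω := hball (closedBall_subset_ball (by linarith) (hsupp a hY))
    exact (χ.contDiff.contDiffAt.mul
      ((EuclideanSpace.proj a : E3 →L[ℝ] ℝ).contDiff.contDiffAt.comp Y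
        (hφ.contDiffAt hΩ hYΩ))).contMDiffAt
  have hfc : ∀ a, HasCompactSupport (f a) := fun a => χ.hasCompactSupport.mul_right
  have hsub : ball X (ρ / 3) ⊆ Ω := (ball_subset_ball (by linarith)).trans hball
  have hfφ : ∀ a i, ∀ Y ∈ ball X (ρ / 3),
      fderiv ℝ (f a) Y (EuclideanSpace.single i 1) = defGrad φ Y a i := by
    intro a i Y hY
    have heq : f a =ᶠ[nhds Y] fun Z => φ Z a := by
      filter_upwards [isOpen_ball.mem_nhds hY] with Z hZ
      simp only [f, χ.one_of_mem_closedBall (ball_subset_closedBall hZ), one_mul]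
    rw [heq.fderiv_eq, defGrad_eq_partialDeriv_apply (hφ.differentiableAt hΩ (hsub hY)),
      partialDeriv]
  have hfΔ : ∀ a, ∀ Y ∈ ball X (ρ / 3), ∑ i, fderiv ℝ (fun Z => fderiv ℝ (f a) Z
      (EuclideanSpace.single i 1)) Y (EuclideanSpace.single i 1) = 0 := by
    intro a Y hY
    rw [← hΔ Y (hsub hY) a]
    refine Finset.sum_congr rfl fun i _ => ?_
    have heq : (fun Z => fderiv ℝ (f a) Z (EuclideanSpace.single i 1)) =ᶠ[nhds Y]
        fun Z => defGrad φ Z a i := by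
      filter_upwards [isOpen_ball.mem_nhds hY] with Z hZ using hfφ a i Z hZ
    rw [heq.fderiv_eq, partialDeriv]
  have hR : 0 < ρ / 3 := by positivity
  filter_upwards [ball_mem_nhds X hR] with Y hY
  ext a i
  have := fderiv_eq_of_sum_sq_fderiv_eq (EuclideanSpace.basisFun (Fin 3) ℝ) hf hfc (c := X)
    (R := ρ / 3) (m := m) hR
    (by simpa only [EuclideanSpace.basisFun_apply] using hfΔ)
    (fun Z hZ => by
      simp only [EuclideanSpace.basisFun_apply, hfφ _ _ Z hZ]
      exact htr Z (hsub hZ)) hY a i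
  rwa [EuclideanSpace.basisFun_apply, hfφ a i Y hY, hfφ a i X (mem_ball_self hR)] at this

theorem fderiv_eq_of_defGrad_eq {X Y : E3} (h : defGrad φ Y = defGrad φ X) :
    fderiv ℝ φ Y = fderiv ℝ φ X := by
  ext v a
  rw [fderiv_apply_eq_sum_defGrad, fderiv_apply_eq_sum_defGrad, h]

theorem IsUniversal.isHomogeneous {k : WithTop ℕ∞} (hφ : IsDeformation Ω φ)
    (hu : IsUniversal k Ω φ) (hΩ : IsOpen Ω) (hΩc : IsConnected Ω) : IsHomogeneous Ω φ := by
  obtain ⟨X₀, hX₀⟩ := hΩc.nonempty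
  have htr : ∀ X ∈ Ω, ∑ a, ∑ A, defGrad φ X a A ^ 2 = (leftCauchyGreen φ X₀).trace := by
    intro X hX
    rw [← trace_leftCauchyGreen]
    exact hΩ.is_const_of_fderiv_eq_zero (𝕜 := ℝ) hΩc.isPreconnected
      (fun Y hY => (hu.fderiv_trace_eq_zero hφ hΩ hY).1.differentiableWithinAt)
      (fun Y hY => (hu.fderiv_trace_eq_zero hφ hΩ hY).2) hX hX₀
  have hloc : ∀ X ∈ Ω, fderiv ℝ φ =ᶠ[nhds X] fun _ => fderiv ℝ φ X := by
    intro X hX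
    filter_upwards [hφ.eventually_defGrad_eq hΩ htr
      (fun Y hY => hu.sum_partialDeriv_defGrad_eq_zero hφ hΩ hY) hX] with Y hY
    exact fderiv_eq_of_defGrad_eq hY
  have hconst : ∀ X ∈ Ω, fderiv ℝ φ X = fderiv ℝ φ X₀ := fun X hX =>
    hΩ.is_const_of_fderiv_eq_zero (𝕜 := ℝ) hΩc.isPreconnected
      (fun Y hY => ((hloc Y hY).differentiableAt_iff.2
        (differentiableAt_const _)).differentiableWithinAt)
      (fun Y hY => by rw [(hloc Y hY).fderiv_eq]; simp) hX hX₀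
  obtain ⟨d, hd⟩ := hΩ.exists_eq_add_of_fderiv_eq hΩc.isPreconnected
    (fun Y hY => (hφ.differentiableAt hΩ hY).differentiableWithinAt)
    (fderiv ℝ φ X₀).differentiable.differentiableOn
    (fun Y hY => by rw [hconst Y hY, ContinuousLinearMap.fderiv])
  exact ⟨fderiv ℝ φ X₀, d, hd⟩

/-- The stress of a homogeneous deformation is constant. -/
theorem IsHomogeneous.isUniversal (hφ : IsDeformation Ω φ) (hh : IsHomogeneous Ω φ)
    (hΩ : IsOpen Ω) (k : WithTop ℕ∞) : IsUniversal k Ω φ := by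
  obtain ⟨A, d, hA⟩ := hh
  have hF : ∀ X ∈ Ω, ∀ Y ∈ Ω, defGrad φ X = defGrad φ Y := by
    have : ∀ X ∈ Ω, fderiv ℝ φ X = A := by
      intro X hX
      have heq : φ =ᶠ[nhds X] fun Y => A Y + d := by
        filter_upwards [hΩ.mem_nhds hX] with Y hY using hA Y hY
      rw [heq.fderiv_eq, fderiv_add_const, ContinuousLinearMap.fderiv]
    intro X hX Y hY
    ext a i
    simp [defGrad, partialDeriv, this X hX, this Y hY]
  rintro M _ ⟨X, hX, rfl⟩
  obtain ⟨L, hL, -⟩ := hφ.exists_hasFDerivAt_invFunOn hΩ hX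
  have hmem : ∀ᶠ y in nhds (φ X), Function.invFunOn φ Ω y ∈ Ω := by
    apply hL.continuousAt
    rw [hφ.invFunOn_apply hX]
    exact hΩ.mem_nhds hX
  have hσ : ∀ a b, (fun y => M.spatialStress Ω φ y a b) =ᶠ[nhds (φ X)]
      fun _ => M.stress φ X a b := by
    intro a b
    filter_upwards [hmem] with y hy
    simp only [IsotropicCauchySolid.spatialStress, IsotropicCauchySolid.stress, leftCauchyGreen,
      cTensor, hF _ hy X hX]
  refine ⟨fun a b => (hσ a b).differentiableAt_iff.2 (differentiableAt_const _), fun a => ?_⟩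
  refine Finset.sum_eq_zero fun b _ => ?_
  rw [partialDeriv, (hσ a b).fderiv_eq]
  simp

end Rigidity

theorem proposition1 (k : WithTop ℕ∞) (hk : 1 ≤ k)
    (Ω : Set E3) (hΩ : IsOpen Ω) (hΩc : IsConnected Ω) :
    {φ : E3 → E3 | IsDeformation Ω φ ∧ IsUniversal k Ω φ} =
      {φ : E3 → E3 | IsDeformation Ω φ ∧ IsHomogeneous Ω φ} := by
  ext φ
  exact and_congr_right fun hφ =>
    ⟨fun hu => hu.isHomogeneous hφ hΩ hΩc, fun hh => hh.isUniversal hφ hΩ k⟩
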